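/- For $n\ge 1$ let $B_n$ be the braid group on $n$ strands with standard generators $\sigma_1,\dots,\sigma_{n-1}$ (positive crossings), let $w(\beta)\in\mathbb Z$ be the exponent sum of $\beta\in B_n$, let $\widehat\beta$ be the closure of $\beta$, an oriented link, and let $\Delta\in B_n$ be the Garside element (positive half twist), $\Delta=(\sigma_1\cdots\sigma_{n-1})(\sigma_1\cdots\sigma_{n-2})\cdots(\sigma_1)$. Let $P_L(v,z)\in\mathbb Z[v^{\pm1},z^{\pm1}]$ be the Homfly polynomial of an oriented link $L$, i.e. the unique isotopy invariant of oriented links with $P_{\mathrm{unknot}}=1$ and $v^{-1}P_{L_+}-vP_{L_-}=zP_{L_0}$ for links $L_+,L_-,L_0$ that differ only at one crossing, which is positive, negative, and smoothed compatibly with the orientation, respectively. The left (right) column of $P_L$ is the coefficient, a Laurent polynomial in $z$, of the lowest (highest) power of $v$ that occurs in $P_L$ with non-zero coefficient. For $\beta\in B_n$, the lower Morton–Franks–Williams (MFW) estimate $w(\beta)-n+1\le$ (lowest $v$-degree of $P_{\widehat\beta}$) is called sharp for $\beta$ if it is an equality, and the upper MFW estimate (highest $v$-degree of $P_{\widehat\beta}$)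 $\le w(\beta)+n-1$ is called sharp for $\beta$ if it is an equality. Theorem. For every $n\ge1$ and every braid $\beta\in B_n$, the lower MFW estimate is sharp for $\beta$ if and only if the upper MFW estimate is sharp for $\beta\Delta^2$. If this is the case, then $$\text{left column of }P_{\widehat\beta}=(-1)^{n-1}\cdot\text{right column of }P_{\widehat{\beta\Delta^2}}.$$ -/

import Mathlib

noncomputable section

open LaurentPolynomial

namespace BraidLink

/-! ### Braid groups -/

/-- Artin's relations between the generators `σ₁, …, σₙ₋₁` (indexed here from `0`):
far commutation and the braid relation. -/
def braidRels (n : ℕ) : Set (FreeGroup (Fin (n - 1))) :=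
  {r | ∃ i j : Fin (n - 1), (i : ℕ) + 1 < j ∧
      r = (FreeGroup.of i * FreeGroup.of j) * (FreeGroup.of j * FreeGroup.of i)⁻¹} ∪
  {r | ∃ i j : Fin (n - 1), (i : ℕ) + 1 = j ∧
      r = (FreeGroup.of i * FreeGroup.of j * FreeGroup.of i) *
        (FreeGroup.of j * FreeGroup.of i * FreeGroup.of j)⁻¹}

/-- The braid group on `n` strands. -/
abbrev BraidGroup (n : ℕ) : Type := PresentedGroup (braidRels n)

/-- The standard generators of the braid group on `m + 1` strands (positive crossings);
`σ i` is usually called `σ_{i+1}`. -/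
def σ {m : ℕ} (i : Fin m) : BraidGroup (m + 1) :=
  PresentedGroup.of (α := Fin (m + 1 - 1)) i

theorem σ_comm {m : ℕ} (i j : Fin m) (h : (i : ℕ) + 1 < j) : σ i * σ j = σ j * σ i :=
  PresentedGroup.mk_eq_mk_of_mul_inv_mem (rels := braidRels (m + 1))
    (Or.inl ⟨i, j, h, rfl⟩)

theorem σ_braid {m : ℕ} (i j : Fin m) (h : (i : ℕ) + 1 = j) :
    σ i * σ j * σ i = σ j * σ i * σ j :=
  PresentedGroup.mk_eq_mk_of_mul_inv_mem (rels := braidRels (m + 1))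
    (Or.inr ⟨i, j, h, rfl⟩)

/-- A map on generators that respects Artin's relations extends to the braid group. -/
def braidLift {G : Type*} [Group G] {m : ℕ} (f : Fin m → G)
    (h₁ : ∀ i j : Fin m, (i : ℕ) + 1 < j → f i * f j = f j * f i)
    (h₂ : ∀ i j : Fin m, (i : ℕ) + 1 = j → f i * f j * f i = f j * f i * f j) :
    BraidGroup (m + 1) →* G :=
  PresentedGroup.toGroup (f := f) (rels := braidRels (m + 1)) (by
    rintro r (⟨i, j, h, rfl⟩ | ⟨i, j, h, rfl⟩)
    · simpa only [map_mul, map_inv, FreeGroup.lift_apply_of, mul_inv_eq_one] using h₁ i j h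
    · simpa only [map_mul, map_inv, FreeGroup.lift_apply_of, mul_inv_eq_one] using h₂ i j h)

theorem braidLift_σ {G : Type*} [Group G] {m : ℕ} (f : Fin m → G) (h₁) (h₂) (i : Fin m) :
    braidLift f h₁ h₂ (σ i) = f i :=
  PresentedGroup.toGroup.of _

theorem braid_induction {m : ℕ} {p : BraidGroup (m + 1) → Prop} (one : p 1)
    (mul : ∀ a b, p a → p b → p (a * b)) (gen : ∀ i : Fin m, p (σ i))
    (inv : ∀ i : Fin m, p (σ i)⁻¹) (β : BraidGroup (m + 1)) : p β := by
  have h : β ∈ Subgroup.closure (Set.range (PresentedGroup.of (rels := braidRels (m + 1)))) := by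
    rw [PresentedGroup.closure_range_of]; trivial
  induction h using Subgroup.closure_induction'' with
  | mem x hx => obtain ⟨i, rfl⟩ := hx; exact gen i
  | inv_mem x hx => obtain ⟨i, rfl⟩ := hx; exact inv i
  | one => exact one
  | mul x y _ _ hx hy => exact mul x y hx hy

/-- The inclusion of the braid group on `m + 1` strands into that on `m + 2` strands, which adds
a trivial last strand. -/
def addStrand {m : ℕ} : BraidGroup (m + 1) →* BraidGroup (m + 2) :=
  braidLift (fun i : Fin m => σ i.castSucc)
    (fun i j h => σ_comm _ _ (by simpa using h)) (fun i j h => σ_braid _ _ (by simpa using h))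

/-- The exponent sum `w`. -/
def exponentSum {m : ℕ} (β : BraidGroup (m + 1)) : ℤ :=
  (braidLift (fun _ : Fin m => Multiplicative.ofAdd (1 : ℤ))
    (fun _ _ _ => rfl) (fun _ _ _ => rfl) β).toAdd

/-- Garside's positive half twist `Δ` on `m + 1` strands:
`Δ_{n} = (σ₁ σ₂ ⋯ σ_{n-1}) Δ_{n-1}`, with `Δ₁ = 1`. -/
def garside : (m : ℕ) → BraidGroup (m + 1)
  | 0 => 1
  | m + 1 => (List.ofFn fun i : Fin (m + 1) => σ i).prod * addStrand (garside m)

theorem addStrand_σ {m : ℕ} (i : Fin m) : addStrand (σ i) = σ i.castSucc := braidLift_σ _ _ _ i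

theorem addStrand_addStrand_comm {m : ℕ} (a : BraidGroup (m + 1)) :
    addStrand (addStrand a) * σ (Fin.last (m + 1)) =
      σ (Fin.last (m + 1)) * addStrand (addStrand a) := by
  induction a using braid_induction with
  | one => simp
  | mul a b ha hb => simp only [map_mul, mul_assoc]; rw [hb, ← mul_assoc, ha, mul_assoc]
  | gen i =>
    simp only [addStrand_σ]
    exact σ_comm _ _ (by simp)
  | inv i =>
    simp only [map_inv, addStrand_σ]
    exact (Commute.inv_left (σ_comm _ _ (by simp) : Commute _ _))

theorem exponentSum_mul {m : ℕ} (a b : BraidGroup (m + 1)) :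
    exponentSum (a * b) = exponentSum a + exponentSum b := by simp [exponentSum]

theorem exponentSum_inv {m : ℕ} (a : BraidGroup (m + 1)) :
    exponentSum a⁻¹ = - exponentSum a := by simp [exponentSum]

theorem exponentSum_one {m : ℕ} : exponentSum (1 : BraidGroup (m + 1)) = 0 := by
  simp [exponentSum]

theorem exponentSum_σ {m : ℕ} (i : Fin m) : exponentSum (σ i) = 1 := by
  simp [exponentSum, braidLift_σ]

theorem exponentSum_addStrand {m : ℕ} (a : BraidGroup (m + 1)) :
    exponentSum (addStrand a) = exponentSum a := by
  induction a using braid_induction with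
  | one => simp [exponentSum_one]
  | mul a b ha hb => simp [exponentSum_mul, ha, hb]
  | gen i => simp [addStrand_σ, exponentSum_σ]
  | inv i => simp [addStrand_σ, exponentSum_σ, exponentSum_inv]

/-! ### Closed braids and oriented links -/

/-- The moves that do not change the closure: conjugation and stabilization. -/
inductive MarkovMove :
    (Σ m : ℕ, BraidGroup (m + 1)) → (Σ m : ℕ, BraidGroup (m + 1)) → Prop
  | conj {m : ℕ} (α β : BraidGroup (m + 1)) : MarkovMove ⟨m, α * β⟩ ⟨m, β * α⟩
  | stab_pos {m : ℕ} (β : BraidGroup (m + 1)) :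
      MarkovMove ⟨m, β⟩ ⟨m + 1, addStrand β * σ (Fin.last m)⟩
  | stab_neg {m : ℕ} (β : BraidGroup (m + 1)) :
      MarkovMove ⟨m, β⟩ ⟨m + 1, addStrand β * (σ (Fin.last m))⁻¹⟩

/-- Isotopy classes of (non-empty) oriented links. By the theorems of Alexander and Markov, taking
closures identifies them with the classes of braids under the equivalence relation generated by
conjugation and stabilization. (The Homfly polynomial of closed braids does not depend on these
theorems: every isotopy invariant of oriented links that satisfies the skein relation induces, on
closed braids, a function as in `IsHomfly` below, and there is only one such function.) -/
def OrientedLink : Type := Quot MarkovMove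

/-- The closure of a braid. -/
def braidClosure {m : ℕ} (β : BraidGroup (m + 1)) : OrientedLink := Quot.mk _ ⟨m, β⟩

/-! ### The Homfly polynomial -/

/-- The ring `ℤ[z, z⁻¹][v, v⁻¹]`: the outer Laurent variable is `v`, the inner one is `z`. -/
abbrev VZPoly : Type := ℤ[T;T⁻¹][T;T⁻¹]

/-- `v ^ k` for an integer `k`. -/
abbrev vpow (k : ℤ) : VZPoly := LaurentPolynomial.T k

/-- `z ^ k` for an integer `k`. -/
abbrev zpow (k : ℤ) : VZPoly := LaurentPolynomial.C (LaurentPolynomial.T k)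

/-- `P` is normalized to be `1` on the unknot and satisfies the skein relation
`v⁻¹ P(L₊) - v P(L₋) = z P(L₀)`, where `L₊`, `L₋`, `L₀` differ at one crossing, which is
respectively positive, negative and smoothed. -/
structure IsHomfly (P : OrientedLink → VZPoly) : Prop where
  unknot : P (braidClosure (1 : BraidGroup 1)) = 1
  skein : ∀ {m : ℕ} (α β : BraidGroup (m + 1)) (i : Fin m),
    vpow (-1) * P (braidClosure (α * σ i * β)) - vpow 1 * P (braidClosure (α * (σ i)⁻¹ * β)) =
      zpow 1 * P (braidClosure (α * β))

/-! #### Uniqueness -/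

section Skein

variable {M : Type*} [AddCommGroup M] [Module VZPoly M] (N : Submodule VZPoly M)

/-- Functions on a braid group that satisfy the skein relation. -/
def SkeinFun {m : ℕ} (φ : BraidGroup (m + 1) → M) : Prop :=
  ∀ (α β : BraidGroup (m + 1)) (i : Fin m),
    vpow (-1) • φ (α * σ i * β) - vpow 1 • φ (α * (σ i)⁻¹ * β) = zpow 1 • φ (α * β)

theorem vpow_smul_smul (k l : ℤ) (x : M) : vpow k • vpow l • x = vpow (k + l) • x := by
  rw [smul_smul, ← LaurentPolynomial.T_add]

variable {N} in
theorem SkeinFun.neg_mem {m : ℕ} {φ : BraidGroup (m + 1) → M} (hφ : SkeinFun φ)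
    (α β : BraidGroup (m + 1)) (i : Fin m) (h₁ : φ (α * σ i * β) ∈ N) (h₀ : φ (α * β) ∈ N) :
    φ (α * (σ i)⁻¹ * β) ∈ N := by
  have h := hφ α β i
  have h' : φ (α * (σ i)⁻¹ * β) =
      vpow (-1) • (vpow (-1) • φ (α * σ i * β) - zpow 1 • φ (α * β)) := by
    rw [← h, sub_sub_cancel, vpow_smul_smul]; simp
  rw [h']
  exact N.smul_mem _ (N.sub_mem (N.smul_mem _ h₁) (N.smul_mem _ h₀))

variable {N} in
theorem SkeinFun.pos_mem {m : ℕ} {φ : BraidGroup (m + 1) → M} (hφ : SkeinFun φ)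
    (α β : BraidGroup (m + 1)) (i : Fin m) (h₁ : φ (α * (σ i)⁻¹ * β) ∈ N) (h₀ : φ (α * β) ∈ N) :
    φ (α * σ i * β) ∈ N := by
  have h := hφ α β i
  have h' : φ (α * σ i * β) =
      vpow 1 • (vpow 1 • φ (α * (σ i)⁻¹ * β) + zpow 1 • φ (α * β)) := by
    rw [← h, add_sub_cancel, vpow_smul_smul]; simp
  rw [h']
  exact N.smul_mem _ (N.add_mem (N.smul_mem _ h₁) (N.smul_mem _ h₀))

theorem SkeinFun.translate {m : ℕ} {φ : BraidGroup (m + 1) → M} (hφ : SkeinFun φ)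
    (γ : BraidGroup (m + 1)) : SkeinFun fun x => φ (x * γ) := fun α β i => by
  simpa only [mul_assoc] using hφ α (β * γ) i

/-- A skein function takes values in `N` if it does so on `B_{n-1}` and `B_{n-1} σ_{n-1} B_{n-1}`. -/
theorem SkeinFun.mem {m : ℕ} {φ : BraidGroup (m + 2) → M} (hφ : SkeinFun φ)
    (h₀ : ∀ a, φ (addStrand a) ∈ N)
    (h₁ : ∀ a b, φ (addStrand a * σ (Fin.last m) * addStrand b) ∈ N) (β : BraidGroup (m + 2)) :
    φ β ∈ N := by
  induction m with
  | zero =>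
    have key : ∀ β : BraidGroup 2, ∀ φ : BraidGroup 2 → M, SkeinFun φ → φ 1 ∈ N →
        φ (σ (Fin.last 0)) ∈ N → φ β ∈ N ∧ φ (σ (Fin.last 0) * β) ∈ N := by
      intro β
      induction β using braid_induction with
      | one => intro φ _ h₀ h₁; simpa using ⟨h₀, h₁⟩
      | mul a b ha hb =>
        intro φ hφ h₀ h₁
        have := ha _ (hφ.translate b) (by simpa using (hb φ hφ h₀ h₁).1)
          (by simpa using (hb φ hφ h₀ h₁).2)
        simpa [mul_assoc] using this
      | gen i =>
        intro φ hφ h₀ h₁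
        obtain rfl : i = Fin.last 0 := Subsingleton.elim _ _
        refine ⟨h₁, ?_⟩
        have := hφ.pos_mem (σ (Fin.last 0)) 1 (Fin.last 0) (N := N)
        simp only [mul_inv_cancel, mul_one] at this
        exact this h₀ h₁
      | inv i =>
        intro φ hφ h₀ h₁
        obtain rfl : i = Fin.last 0 := Subsingleton.elim _ _
        refine ⟨?_, by simpa using h₀⟩
        have := hφ.neg_mem 1 1 (Fin.last 0) (N := N)
        simp only [mul_one, one_mul] at this
        exact this h₁ h₀
    exact (key β φ hφ (by simpa using h₀ 1) (by simpa using h₁ 1 1)).1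
  | succ m ih =>
    set s : BraidGroup (m + 3) := σ (Fin.last (m + 1)) with hs
    have key : ∀ β : BraidGroup (m + 3), ∀ φ : BraidGroup (m + 3) → M, SkeinFun φ →
        (∀ a, φ (addStrand a) ∈ N) → (∀ a b, φ (addStrand a * s * addStrand b) ∈ N) →
        (∀ a, φ (addStrand a * β) ∈ N) ∧ (∀ a b, φ (addStrand a * s * addStrand b * β) ∈ N) := by
      have gen : ∀ φ : BraidGroup (m + 3) → M, SkeinFun φ →
          (∀ a, φ (addStrand a) ∈ N) → (∀ a b, φ (addStrand a * s * addStrand b) ∈ N) →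
          ∀ a b, φ (addStrand a * s * addStrand b * s) ∈ N := by
        intro φ hφ h₀ h₁ a b
        refine ih (φ := fun b => φ (addStrand a * s * addStrand b * s)) ?_ ?_ ?_ b
        · intro α β i
          have := hφ (addStrand a * s * addStrand α) (addStrand β * s) i.castSucc
          simpa [mul_assoc, addStrand_σ] using this
        · intro c
          have hc := addStrand_addStrand_comm c
          rw [← hs] at hc
          have e : addStrand a * s * addStrand (addStrand c) * s =
              addStrand (a * addStrand c) * s * s * 1 := by
            rw [map_mul, mul_assoc (addStrand a) s, ← hc]; group
          show φ _ ∈ N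
          rw [e]
          refine hφ.pos_mem _ _ _ ?_ ?_
          · simpa [← hs] using h₀ (a * addStrand c)
          · simpa using h₁ (a * addStrand c) 1
        · intro c d
          have hd : ∀ d : BraidGroup (m + 1), _ := addStrand_addStrand_comm
          rw [← hs] at hd
          set u : BraidGroup (m + 3) := σ (Fin.last m).castSucc with hu
          have hb : u * s * u = s * u * s := σ_braid _ _ (by simp)
          have e : addStrand a * s * addStrand (addStrand c * σ (Fin.last m) * addStrand d) * s =
              addStrand (a * addStrand c * σ (Fin.last m)) * s *
                addStrand (σ (Fin.last m) * addStrand d) := by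
            simp only [map_mul, addStrand_σ, ← hu]
            calc _ = addStrand a * (s * addStrand (addStrand c)) * u *
                  (addStrand (addStrand d) * s) := by group
              _ = addStrand a * addStrand (addStrand c) * (s * u * s) *
                  addStrand (addStrand d) := by rw [hd d, ← hd c]; group
              _ = _ := by rw [← hb]; group
          show φ _ ∈ N
          rw [e]
          exact h₁ _ _
      intro β
      induction β using braid_induction with
      | one => intro φ _ h₀ h₁; simpa using ⟨h₀, h₁⟩
      | mul a b ha hb =>
        intro φ hφ h₀ h₁
        obtain ⟨h₂, h₃⟩ := hb φ hφ h₀ h₁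
        simpa [mul_assoc] using ha _ (hφ.translate b) h₂ h₃
      | gen i =>
        intro φ hφ h₀ h₁
        induction i using Fin.lastCases with
        | last => exact ⟨fun a => by simpa using h₁ a 1, gen φ hφ h₀ h₁⟩
        | cast i =>
          refine ⟨fun a => ?_, fun a b => ?_⟩
          · simpa [addStrand_σ] using h₀ (a * σ i)
          · simpa [addStrand_σ, mul_assoc] using h₁ a (b * σ i)
      | inv i =>
        intro φ hφ h₀ h₁
        induction i using Fin.lastCases with
        | last =>
          refine ⟨fun a => ?_, fun a b => ?_⟩
          · have := hφ.neg_mem (addStrand a) 1 (Fin.last (m + 1)) (N := N)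
            simp only [mul_one] at this
            exact this (by simpa using h₁ a 1) (h₀ a)
          · have := hφ.neg_mem (addStrand a * s * addStrand b) 1 (Fin.last (m + 1)) (N := N)
            simp only [mul_one] at this
            exact this (gen φ hφ h₀ h₁ a b) (h₁ a b)
        | cast i =>
          refine ⟨fun a => ?_, fun a b => ?_⟩
          · simpa [addStrand_σ] using h₀ (a * (σ i)⁻¹)
          · simpa [addStrand_σ, mul_assoc] using h₁ a (b * (σ i)⁻¹)
    simpa using (key β φ hφ h₀ h₁).1 1

/-- A Markov-invariant family of skein functions takes values in the span of its value at the
trivial braid on one strand. -/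
theorem skein_mem (P : OrientedLink → M) (h : P (braidClosure (1 : BraidGroup 1)) ∈ N)
    (hP : ∀ m, SkeinFun fun β : BraidGroup (m + 1) => P (braidClosure β)) (L : OrientedLink) :
    P L ∈ N := by
  obtain ⟨⟨m, β⟩, rfl⟩ := Quot.exists_rep L
  change P (braidClosure β) ∈ N
  induction m with
  | zero =>
    obtain rfl : β = 1 := by
      induction β using braid_induction with
      | one => rfl
      | mul a b ha hb => rw [ha, hb, mul_one]
      | gen i => exact i.elim0
      | inv i => exact i.elim0
    exact h
  | succ m ih =>
    have pos : ∀ a : BraidGroup (m + 1),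
        P (braidClosure (addStrand a * σ (Fin.last m))) = P (braidClosure a) := fun a =>
      congrArg P (Quot.sound (MarkovMove.stab_pos a)).symm
    have neg : ∀ a : BraidGroup (m + 1),
        P (braidClosure (addStrand a * (σ (Fin.last m))⁻¹)) = P (braidClosure a) := fun a =>
      congrArg P (Quot.sound (MarkovMove.stab_neg a)).symm
    refine SkeinFun.mem N (hP (m + 1)) (fun a => ?_) (fun a b => ?_) β
    · have := hP (m + 1) (addStrand a) 1 (Fin.last m)
      simp only [mul_one, pos, neg] at this
      have e : P (braidClosure (addStrand a)) = zpow (-1) • zpow 1 • P (braidClosure (addStrand a)) := by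
        rw [smul_smul, ← map_mul, ← LaurentPolynomial.T_add]; simp
      rw [e, ← this]
      exact N.smul_mem _ (N.sub_mem (N.smul_mem _ (ih a)) (N.smul_mem _ (ih a)))
    · have e : P (braidClosure (addStrand a * σ (Fin.last m) * addStrand b)) = P (braidClosure (b * a)) := by
        rw [← pos, map_mul, mul_assoc (addStrand b)]
        exact congrArg P (Quot.sound (MarkovMove.conj (addStrand a * σ (Fin.last m)) (addStrand b)))
      rw [e]
      exact ih _

end Skein

theorem IsHomfly.unique {P Q : OrientedLink → VZPoly} (hP : IsHomfly P) (hQ : IsHomfly Q) :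
    P = Q := by
  funext L
  have := skein_mem (LinearMap.eqLocus (LinearMap.fst VZPoly VZPoly VZPoly)
    (LinearMap.snd VZPoly VZPoly VZPoly)) (fun L => (P L, Q L))
    (by simp [LinearMap.mem_eqLocus, hP.unknot, hQ.unknot])
    (fun m α β i => Prod.ext (hP.skein α β i) (hQ.skein α β i)) L
  exact this

/-! #### Existence, by quantum traces -/

section RMatrix

variable {ι : Type*} [DecidableEq ι] {N : ℕ}

/-- The action of a positive crossing of the strands `a` and `b` on the tensor power of an
`N`-dimensional space: the `R`-matrix of type `A`. -/
def crossing (q : ℚ) (a b : ι) : Module.End ℚ ((ι → Fin N) → ℚ) where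
  toFun φ f := if f a = f b then q * φ f else
    φ (f ∘ Equiv.swap a b) + if f b < f a then (q - q⁻¹) * φ f else 0
  map_add' φ ψ := by ext f; simp only [Pi.add_apply]; split_ifs <;> ring
  map_smul' c φ := by ext f; simp only [Pi.smul_apply, smul_eq_mul, RingHom.id_apply]; split_ifs <;> ring

theorem crossing_apply (q : ℚ) (a b : ι) (φ : (ι → Fin N) → ℚ) (f : ι → Fin N) :
    crossing q a b φ f = if f a = f b then q * φ f else
    φ (f ∘ Equiv.swap a b) + if f b < f a then (q - q⁻¹) * φ f else 0 := rfl

theorem crossing_sq {q : ℚ} (hq : q ≠ 0) (a b : ι) :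
    crossing q a b * crossing q a b =
      (1 + (q - q⁻¹) • crossing q a b : Module.End ℚ ((ι → Fin N) → ℚ)) := by
  refine LinearMap.ext fun φ => funext fun f => ?_
  have hs : (f ∘ Equiv.swap a b) ∘ Equiv.swap a b = f := by
    ext x; simp
  simp only [Module.End.mul_apply, LinearMap.add_apply, LinearMap.smul_apply, Pi.add_apply,
    Pi.smul_apply, smul_eq_mul, Module.End.one_apply, crossing_apply, Function.comp_apply,
    Equiv.swap_apply_left, Equiv.swap_apply_right, hs]
  rcases lt_trichotomy (f a) (f b) with h | h | h
  · simp [h, h.ne, h.ne', h.not_gt]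
    try ring
  · simp only [h, if_true]; field_simp; try ring
  · simp [h, h.ne, h.ne', h.not_gt]
    try ring

theorem crossing_comm (q : ℚ) {a b c d : ι} (hac : a ≠ c) (had : a ≠ d) (hbc : b ≠ c)
    (hbd : b ≠ d) : crossing q a b * crossing q c d =
      (crossing q c d * crossing q a b : Module.End ℚ ((ι → Fin N) → ℚ)) := by
  refine LinearMap.ext fun φ => funext fun f => ?_
  have hs : (f ∘ Equiv.swap a b) ∘ Equiv.swap c d = (f ∘ Equiv.swap c d) ∘ Equiv.swap a b := by
    ext x
    simp only [Function.comp_apply, Equiv.swap_apply_def]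
    split_ifs <;> simp_all
  simp only [Module.End.mul_apply, crossing_apply, Function.comp_apply,
    Equiv.swap_apply_of_ne_of_ne hac had, Equiv.swap_apply_of_ne_of_ne hbc hbd,
    Equiv.swap_apply_of_ne_of_ne hac.symm hbc.symm, Equiv.swap_apply_of_ne_of_ne had.symm hbd.symm,
    hs]
  split_ifs <;> ring

theorem tri (x y : Fin N) :
    (x < y ∧ (x = y) = False ∧ (y = x) = False ∧ (x < y) = True ∧ (y < x) = False) ∨
    (x = y ∧ (x = y) = True ∧ (y = x) = True ∧ (x < y) = False ∧ (y < x) = False) ∨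
    (y < x ∧ (x = y) = False ∧ (y = x) = False ∧ (x < y) = False ∧ (y < x) = True) := by
  rcases lt_trichotomy x y with h | h | h
  · simp [h, h.ne, h.ne', h.le]
  · simp [h]
  · simp [h, h.ne, h.ne', h.le]

theorem crossing_braid {q : ℚ} (hq : q ≠ 0) {a b c : ι} (hab : a ≠ b) (hac : a ≠ c) (hbc : b ≠ c) :
    crossing q a b * crossing q b c * crossing q a b =
      (crossing q b c * crossing q a b * crossing q b c : Module.End ℚ ((ι → Fin N) → ℚ)) := by
  refine LinearMap.ext fun φ => funext fun f => ?_
  have hs : ((f ∘ Equiv.swap a b) ∘ Equiv.swap b c) ∘ Equiv.swap a b =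
      ((f ∘ Equiv.swap b c) ∘ Equiv.swap a b) ∘ Equiv.swap b c := by
    ext x
    simp only [Function.comp_apply, Equiv.swap_apply_def]
    split_ifs <;> simp_all
  have hs1 : (f ∘ Equiv.swap a b) ∘ Equiv.swap a b = f := by ext x; simp
  have hs2 : (f ∘ Equiv.swap b c) ∘ Equiv.swap b c = f := by ext x; simp
  simp only [Module.End.mul_apply, crossing_apply, Function.comp_apply,
    Equiv.swap_apply_left, Equiv.swap_apply_right,
    Equiv.swap_apply_of_ne_of_ne hac.symm hbc.symm, Equiv.swap_apply_of_ne_of_ne hab hac,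
    hs, hs1, hs2]
  have hqi : q * q⁻¹ = 1 := mul_inv_cancel₀ hq
  generalize φ (f ∘ _) = φ₁
  generalize φ (f ∘ _) = φ₂
  generalize φ ((f ∘ _) ∘ _) = φ₃
  generalize φ ((f ∘ _) ∘ _) = φ₄
  generalize f a = x
  generalize f b = y
  generalize f c = z
  rcases tri x y with ⟨h, h1, h2, h3, h4⟩ | ⟨h, h1, h2, h3, h4⟩ | ⟨h, h1, h2, h3, h4⟩ <;>
  rcases tri y z with ⟨k, k1, k2, k3, k4⟩ | ⟨k, k1, k2, k3, k4⟩ | ⟨k, k1, k2, k3, k4⟩ <;>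
  rcases tri x z with ⟨l, l1, l2, l3, l4⟩ | ⟨l, l1, l2, l3, l4⟩ | ⟨l, l1, l2, l3, l4⟩ <;>
  first
  | (exfalso; clear * - h k l; order)
  | (simp only [h1, h2, h3, h4, k1, k2, k3, k4, l1, l4, if_true, if_false]
     first
     | done
     | ring1
     | linear_combination (q - q⁻¹) * φ f * hqi
     | linear_combination (q⁻¹ - q) * φ f * hqi)


/-- A positive crossing as an invertible operator. -/
def crossingUnit {q : ℚ} (hq : q ≠ 0) (a b : ι) : (Module.End ℚ ((ι → Fin N) → ℚ))ˣ where
  val := crossing q a b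
  inv := crossing q a b - (q - q⁻¹) • 1
  val_inv := by rw [mul_sub, crossing_sq hq, mul_smul_comm, mul_one, add_sub_cancel_right]
  inv_val := by rw [sub_mul, crossing_sq hq, smul_mul_assoc, one_mul, add_sub_cancel_right]

/-- The representation of the braid group on the tensor power of an `N`-dimensional space. -/
def rep (N : ℕ) {q : ℚ} (hq : q ≠ 0) {m : ℕ} :
    BraidGroup (m + 1) →* (Module.End ℚ ((Fin (m + 1) → Fin N) → ℚ))ˣ :=
  braidLift (fun i : Fin m => crossingUnit hq i.castSucc i.succ)
    (fun i j h => Units.ext (crossing_comm q (by simp [Fin.ext_iff]; omega)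
      (by simp [Fin.ext_iff]; omega) (by simp [Fin.ext_iff]; omega) (by simp [Fin.ext_iff]; omega)))
    (fun i j h => Units.ext (by
      have e : j.castSucc = i.succ := by simp [Fin.ext_iff, h]
      simp only [Units.val_mul, crossingUnit, e]
      exact crossing_braid hq (by simp [Fin.ext_iff]) (by simp [Fin.ext_iff]; omega)
        (by simp [Fin.ext_iff]; omega)))

theorem rep_σ (N : ℕ) {q : ℚ} (hq : q ≠ 0) {m : ℕ} (i : Fin m) :
    (rep N hq (σ i) : Module.End ℚ ((Fin (m + 1) → Fin N) → ℚ)) = crossing q i.castSucc i.succ := by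
  rw [rep, braidLift_σ]; rfl

theorem rep_σ_inv (N : ℕ) {q : ℚ} (hq : q ≠ 0) {m : ℕ} (i : Fin m) :
    (rep N hq (σ i)⁻¹ : Module.End ℚ ((Fin (m + 1) → Fin N) → ℚ)) =
      crossing q i.castSucc i.succ - (q - q⁻¹) • 1 := by
  rw [rep, map_inv, braidLift_σ]; rfl

/-- The weights of the quantum trace. -/
def wt (N : ℕ) (q : ℚ) (k : ℕ) : ℚ := q ^ ((N : ℤ) - 1 - 2 * k)

theorem sum_wt (N : ℕ) {q : ℚ} (hq : q ≠ 0) (M : ℕ) :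
    ∑ k ∈ Finset.range M, wt N q k * (q - q⁻¹) = q ^ (N : ℤ) - q ^ ((N : ℤ) - 2 * M) := by
  induction M with
  | zero => simp
  | succ M ih =>
    rw [Finset.sum_range_succ, ih, wt]
    have e1 : q ^ ((N : ℤ) - 1 - 2 * M) * q = q ^ ((N : ℤ) - 2 * M) := by
      rw [← zpow_add_one₀ hq]; congr 1; ring
    have e2 : q ^ ((N : ℤ) - 1 - 2 * M) * q⁻¹ = q ^ ((N : ℤ) - 2 * (M + 1 : ℕ)) := by
      rw [← zpow_sub_one₀ hq]; congr 1; push_cast; ring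
    rw [mul_sub, e1, e2]; ring

theorem sum_wt_crossing (N : ℕ) {q : ℚ} (hq : q ≠ 0) (i M : ℕ) :
    ∑ k ∈ Finset.range M, wt N q k * (if i = k then q else if k < i then q - q⁻¹ else 0) =
      if i < M then q ^ (N : ℤ) else ∑ k ∈ Finset.range M, wt N q k * (q - q⁻¹) := by
  induction M with
  | zero => simp
  | succ M ih =>
    rw [Finset.sum_range_succ, Finset.sum_range_succ, ih]
    rcases lt_trichotomy i M with h | rfl | h
    · simp [h, h.ne, h.not_gt, h.trans (Nat.lt_succ_self M)]
    · rw [if_neg (lt_irrefl i), if_pos rfl, if_pos (Nat.lt_succ_self i), sum_wt N hq, wt,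
        ← zpow_add_one₀ hq]
      have : (N : ℤ) - 1 - 2 * i + 1 = N - 2 * i := by ring
      rw [this]; ring
    · simp [h, h.ne', h.not_gt, show ¬ i < M + 1 by omega]

/-- The diagonal operator of the quantum trace. -/
def diagOp (N : ℕ) (q : ℚ) (n : ℕ) : Module.End ℚ ((Fin n → Fin N) → ℚ) where
  toFun φ f := (∏ i, wt N q (f i)) * φ f
  map_add' φ ψ := by ext f; simp [mul_add]
  map_smul' c φ := by ext f; simp [mul_left_comm]

/-- The quantum trace. -/
def qtrace (N : ℕ) (q : ℚ) {n : ℕ} (A : Module.End ℚ ((Fin n → Fin N) → ℚ)) : ℚ :=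
  LinearMap.trace ℚ _ (diagOp N q n * A)

theorem qtrace_eq (N : ℕ) (q : ℚ) {n : ℕ} (A : Module.End ℚ ((Fin n → Fin N) → ℚ)) :
    qtrace N q A = ∑ f, (∏ i, wt N q (f i)) * A (Pi.single f 1) f := by
  rw [qtrace, LinearMap.trace_eq_matrix_trace ℚ (Pi.basisFun ℚ (Fin n → Fin N)), Matrix.trace]
  refine Finset.sum_congr rfl fun f _ => ?_
  simp [diagOp]

theorem diagOp_comm (N : ℕ) {q : ℚ} (hq : q ≠ 0) {m : ℕ} (β : BraidGroup (m + 1)) :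
    Commute (diagOp N q (m + 1)) (rep N hq β : Module.End ℚ ((Fin (m + 1) → Fin N) → ℚ)) := by
  have key : ∀ i : Fin m, Commute (diagOp N q (m + 1))
      (rep N hq (σ i) : Module.End ℚ ((Fin (m + 1) → Fin N) → ℚ)) := by
    intro i
    rw [rep_σ]
    refine LinearMap.ext fun φ => funext fun f => ?_
    have e : ∏ j, wt N q ((f ∘ Equiv.swap i.castSucc i.succ) j) = ∏ j, wt N q (f j) :=
      Equiv.prod_comp (Equiv.swap i.castSucc i.succ) fun j => wt N q (f j)
    simp only [Module.End.mul_apply, crossing_apply, diagOp, LinearMap.coe_mk, AddHom.coe_mk, e]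
    split_ifs <;> ring
  induction β using braid_induction with
  | one => simp
  | mul a b ha hb => simpa using ha.mul_right hb
  | gen i => exact key i
  | inv i => rw [map_inv]; exact (key i).units_inv_right

theorem qtrace_comm (N : ℕ) {q : ℚ} (hq : q ≠ 0) {m : ℕ} (α β : BraidGroup (m + 1)) :
    qtrace N q (rep N hq (α * β) : Module.End ℚ ((Fin (m + 1) → Fin N) → ℚ)) =
      qtrace N q (rep N hq (β * α) : Module.End ℚ ((Fin (m + 1) → Fin N) → ℚ)) := by
  rw [qtrace, qtrace, map_mul (rep N hq), map_mul (rep N hq), Units.val_mul, Units.val_mul, ← mul_assoc,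
    LinearMap.trace_mul_comm, ← mul_assoc, ← (diagOp_comm N hq β).eq, mul_assoc]

/-- Tensoring with the `k`-th basis vector on the right. -/
def tensorLast {N n : ℕ} (k : Fin N) :
    ((Fin n → Fin N) → ℚ) →ₗ[ℚ] ((Fin (n + 1) → Fin N) → ℚ) where
  toFun φ g := if g (Fin.last n) = k then φ (Fin.init g) else 0
  map_add' φ ψ := by ext g; simp only [Pi.add_apply]; split_ifs <;> simp
  map_smul' c φ := by ext g; simp only [Pi.smul_apply, RingHom.id_apply]; split_ifs <;> simp

theorem tensorLast_apply {N n : ℕ} (k : Fin N) (φ : (Fin n → Fin N) → ℚ) (g : Fin (n + 1) → Fin N) :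
    tensorLast k φ g = if g (Fin.last n) = k then φ (Fin.init g) else 0 := rfl

theorem tensorLast_single {N n : ℕ} (g : Fin (n + 1) → Fin N) :
    tensorLast (g (Fin.last n)) (Pi.single (Fin.init g) 1) = Pi.single g (1 : ℚ) := by
  ext f
  rw [tensorLast_apply, Pi.single_apply, Pi.single_apply]
  by_cases h : f = g
  · simp [h]
  · rw [if_neg h]
    split_ifs with h1 h2
    · exact absurd (by rw [← Fin.snoc_init_self f, ← Fin.snoc_init_self g, h1, h2]) h
    · rfl
    · rfl

theorem rep_addStrand (N : ℕ) {q : ℚ} (hq : q ≠ 0) {m : ℕ} (a : BraidGroup (m + 1)) (k : Fin N)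
    (φ : (Fin (m + 1) → Fin N) → ℚ) :
    (rep N hq (addStrand a) : Module.End ℚ ((Fin (m + 2) → Fin N) → ℚ)) (tensorLast k φ) =
      tensorLast k ((rep N hq a : Module.End ℚ ((Fin (m + 1) → Fin N) → ℚ)) φ) := by
  have key : ∀ (i : Fin m) (φ : (Fin (m + 1) → Fin N) → ℚ),
      crossing q i.castSucc.castSucc i.succ.castSucc (tensorLast k φ) =
        tensorLast k (crossing q i.castSucc i.succ φ) := by
    intro i φ
    ext f
    have e1 : (f ∘ Equiv.swap i.castSucc.castSucc i.succ.castSucc) (Fin.last (m + 1)) =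
        f (Fin.last (m + 1)) := by
      rw [Function.comp_apply, Equiv.swap_apply_of_ne_of_ne]
      · exact (Fin.castSucc_lt_last _).ne'
      · exact (Fin.castSucc_lt_last _).ne'
    have e2 : Fin.init (f ∘ Equiv.swap i.castSucc.castSucc i.succ.castSucc) =
        Fin.init f ∘ Equiv.swap i.castSucc i.succ := by
      ext j
      simp only [Fin.init, Function.comp_apply, Equiv.swap_apply_def, Fin.castSucc_inj]
      split_ifs <;> rfl
    rw [crossing_apply, tensorLast_apply, tensorLast_apply, tensorLast_apply, e1, e2,
      crossing_apply]
    by_cases hk : f (Fin.last (m + 1)) = k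
    · simp only [hk, if_true, Fin.init]
      rfl
    · simp only [if_neg hk, mul_zero, add_zero, ite_self]
  induction a using braid_induction generalizing φ with
  | one => simp
  | mul a b ha hb => simp [ha, hb]
  | gen i => rw [addStrand_σ, rep_σ, rep_σ, Fin.succ_castSucc, key]
  | inv i =>
    rw [map_inv, addStrand_σ, rep_σ_inv, rep_σ_inv, Fin.succ_castSucc]
    simp only [LinearMap.sub_apply, LinearMap.smul_apply, Module.End.one_apply, key, map_sub,
      map_smul]

theorem rep_addStrand_single (N : ℕ) {q : ℚ} (hq : q ≠ 0) {m : ℕ} (a : BraidGroup (m + 1))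
    (g f : Fin (m + 2) → Fin N) :
    (rep N hq (addStrand a) : Module.End ℚ ((Fin (m + 2) → Fin N) → ℚ)) (Pi.single g 1) f =
      if f (Fin.last _) = g (Fin.last _) then
        (rep N hq a : Module.End ℚ ((Fin (m + 1) → Fin N) → ℚ)) (Pi.single (Fin.init g) 1)
          (Fin.init f) else 0 := by
  rw [← tensorLast_single, rep_addStrand, tensorLast_apply]

theorem sum_snoc {N n : ℕ} (F : (Fin (n + 1) → Fin N) → ℚ) :
    ∑ f, F f = ∑ f : Fin n → Fin N, ∑ k : Fin N, F (Fin.snoc f k) := by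
  rw [Finset.sum_comm, ← Fintype.sum_prod_type', ← (Fin.snocEquiv fun _ => Fin N).sum_comp]
  rfl

theorem qtrace_addStrand (N : ℕ) {q : ℚ} (hq : q ≠ 0) {m : ℕ} (a : BraidGroup (m + 1)) :
    qtrace N q (rep N hq (addStrand a) : Module.End ℚ ((Fin (m + 2) → Fin N) → ℚ)) =
      (∑ k : Fin N, wt N q k) *
        qtrace N q (rep N hq a : Module.End ℚ ((Fin (m + 1) → Fin N) → ℚ)) := by
  rw [qtrace_eq, qtrace_eq, sum_snoc, Finset.mul_sum]
  refine Finset.sum_congr rfl fun f _ => ?_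
  simp only [rep_addStrand_single, if_true, Fin.init_snoc, Fin.prod_univ_castSucc,
    Fin.snoc_castSucc, Fin.snoc_last]
  rw [Finset.sum_mul]
  exact Finset.sum_congr rfl fun k _ => by ring

theorem crossing_single {ι : Type*} [Fintype ι] [DecidableEq ι] (q : ℚ) (a b : ι)
    (f : ι → Fin N) :
    crossing q a b (Pi.single f 1) =
      (if f a = f b then q else if f b < f a then q - q⁻¹ else 0) • Pi.single f (1 : ℚ) +
      (if f a = f b then 0 else Pi.single (f ∘ Equiv.swap a b) (1 : ℚ)) := by
  ext g
  have e : g ∘ Equiv.swap a b = f ↔ g = f ∘ Equiv.swap a b := by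
    constructor <;> (rintro rfl; ext x; simp)
  rw [crossing_apply]
  simp only [Pi.add_apply, Pi.smul_apply, smul_eq_mul, Pi.single_apply]
  by_cases hg : g = f
  · subst hg
    by_cases hab : g a = g b
    · simp [hab]
    · have h1 : ¬ g ∘ Equiv.swap a b = g := fun h => hab (by simpa using (congrFun h b))
      have h2 : ¬ g = g ∘ Equiv.swap a b := fun h => h1 h.symm
      simp [hab, h1, h2]
  · by_cases hg' : g = f ∘ Equiv.swap a b
    · subst hg'
      have e3 : (f ∘ Equiv.swap a b) ∘ Equiv.swap a b = f := by ext x; simp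
      simp only [e3, Function.comp_apply, Equiv.swap_apply_left, Equiv.swap_apply_right, hg,
        if_true, if_false, mul_zero, zero_add]
      split_ifs <;> simp_all
    · have hg'' : ¬ g ∘ Equiv.swap a b = f := fun h => hg' (e.1 h)
      simp only [hg, hg'', if_false, mul_zero, ite_self, add_zero, zero_add]
      split_ifs <;> simp [hg']

theorem qtrace_stab (N : ℕ) {q : ℚ} (hq : q ≠ 0) {m : ℕ} (a : BraidGroup (m + 1)) :
    qtrace N q (rep N hq (addStrand a * σ (Fin.last m)) :
      Module.End ℚ ((Fin (m + 2) → Fin N) → ℚ)) =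
      q ^ (N : ℤ) * qtrace N q (rep N hq a : Module.End ℚ ((Fin (m + 1) → Fin N) → ℚ)) := by
  rw [qtrace_eq, qtrace_eq, sum_snoc, Finset.mul_sum]
  refine Finset.sum_congr rfl fun f _ => ?_
  rw [map_mul, Units.val_mul, rep_σ]
  set A := (rep N hq a : Module.End ℚ ((Fin (m + 1) → Fin N) → ℚ)) (Pi.single f 1) f with hA
  have key : ∀ k : Fin N, ((rep N hq (addStrand a) : Module.End ℚ ((Fin (m + 2) → Fin N) → ℚ)) *
      crossing q (Fin.last m).castSucc (Fin.last m).succ :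
        Module.End ℚ ((Fin (m + 2) → Fin N) → ℚ))
        (Pi.single (Fin.snoc f k : Fin (m + 2) → Fin N) 1) (Fin.snoc f k : Fin (m + 2) → Fin N) =
      (if (f (Fin.last m) : ℕ) = k then q else if (k : ℕ) < f (Fin.last m) then q - q⁻¹ else 0) *
        A := by
    intro k
    have el : (Fin.snoc f k : Fin (m + 2) → Fin N) (Fin.last m).succ = k := by simp
    have ea : (Fin.snoc f k : Fin (m + 2) → Fin N) (Fin.last m).castSucc = f (Fin.last m) := by
      simp [Fin.snoc_castSucc]
    rw [Module.End.mul_apply, crossing_single, map_add, map_smul, Pi.add_apply, Pi.smul_apply,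
      rep_addStrand_single, if_pos rfl, Fin.init_snoc, el, ea, smul_eq_mul, ← hA]
    have z : (rep N hq (addStrand a) : Module.End ℚ ((Fin (m + 2) → Fin N) → ℚ))
        (if f (Fin.last m) = k then 0 else Pi.single ((Fin.snoc f k : Fin (m + 2) → Fin N) ∘
          Equiv.swap (Fin.last m).castSucc (Fin.last m).succ) 1)
        (Fin.snoc f k : Fin (m + 2) → Fin N) = 0 := by
      by_cases h : f (Fin.last m) = k
      · simp [h]
      · rw [if_neg h, rep_addStrand_single, if_neg]
        rw [Function.comp_apply, ← Fin.succ_last, Equiv.swap_apply_right, el, ea]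
        exact fun h' => h h'.symm
    rw [z, add_zero]
    simp only [Fin.ext_iff, Fin.lt_def]
  simp only [key, Fin.prod_univ_castSucc, Fin.snoc_castSucc, Fin.snoc_last]
  have hs := sum_wt_crossing N hq (f (Fin.last m)) N
  rw [if_pos (f (Fin.last m)).isLt, ← Fin.sum_univ_eq_sum_range
    (fun k => wt N q k * (if (f (Fin.last m) : ℕ) = k then q else
      if k < (f (Fin.last m) : ℕ) then q - q⁻¹ else 0))] at hs
  rw [← hs, Finset.sum_mul]
  exact Finset.sum_congr rfl fun k _ => by ring

end RMatrix

theorem coeff_eq_zero_of_eval₂ {R : Type*} [CommRing R] (g : R →+* ℚ) (x : ℕ → ℚ)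
    (hx : Function.Injective x) (p : Polynomial R) (h : ∀ k, p.eval₂ g (x k) = 0) (i : ℕ) :
    g (p.coeff i) = 0 := by
  have : p.map g = 0 := Polynomial.eq_zero_of_infinite_isRoot _
    ((Set.infinite_range_of_injective hx).mono (by
      rintro _ ⟨k, rfl⟩
      simpa [Polynomial.IsRoot, Polynomial.eval_map] using h k))
  rw [← Polynomial.coeff_map, this, Polynomial.coeff_zero]

/-- The values of `q` at which we specialize. -/
def q_ (k : ℕ) : ℚ := k + 2

theorem one_lt_q (k : ℕ) : 1 < q_ k := by unfold q_; linarith [(Nat.cast_nonneg k : (0 : ℚ) ≤ k)]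

theorem q_ne (k : ℕ) : q_ k ≠ 0 := by linarith [one_lt_q k]

theorem z_pos (k : ℕ) : 0 < q_ k - (q_ k)⁻¹ := by
  have := inv_lt_one_of_one_lt₀ (one_lt_q k)
  linarith [one_lt_q k]

/-- Specialization at `z = q - q⁻¹`. -/
def specZ (k : ℕ) : ℤ[T;T⁻¹] →+* ℚ :=
  LaurentPolynomial.eval₂ (Int.castRingHom ℚ) (Units.mk0 _ (z_pos k).ne')

/-- Specialization at `z = q - q⁻¹` and `v = q ^ (-N)`, for all `N ≥ 1` and all values of `q`. -/
def spec : VZPoly →+* (ℕ × ℕ → ℚ) :=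
  RingHom.pi fun p => LaurentPolynomial.eval₂ (specZ p.2)
    (Units.mk0 (q_ p.2 ^ (-(p.1 + 1 : ℕ) : ℤ)) (zpow_ne_zero _ (q_ne p.2)))

theorem spec_apply (P : VZPoly) (p : ℕ × ℕ) :
    spec P p = LaurentPolynomial.eval₂ (specZ p.2)
      (Units.mk0 (q_ p.2 ^ (-(p.1 + 1 : ℕ) : ℤ)) (zpow_ne_zero _ (q_ne p.2))) P := rfl

theorem specZ_injective (c : ℤ[T;T⁻¹]) (h : ∀ k, specZ k c = 0) : c = 0 := by
  obtain ⟨n, f, hf⟩ := LaurentPolynomial.exists_T_pow c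
  have hx : Function.Injective fun k => q_ k - (q_ k)⁻¹ := by
    refine StrictMono.injective (strictMono_nat_of_lt_succ fun k => ?_)
    have h1 : q_ k < q_ (k + 1) := by simp [q_]
    have h2 : (q_ (k + 1))⁻¹ ≤ (q_ k)⁻¹ := inv_anti₀ (by linarith [one_lt_q k]) h1.le
    linarith
  have hf0 : f = 0 := by
    ext i
    have := coeff_eq_zero_of_eval₂ (Int.castRingHom ℚ) _ hx f (fun k => by
      have h1 := congrArg (specZ k) hf
      rw [map_mul, h k, zero_mul, specZ, LaurentPolynomial.eval₂_toLaurent] at h1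
      simpa using h1) i
    simpa using this
  rw [hf0, map_zero] at hf
  exact (LaurentPolynomial.isUnit_T n).mul_left_eq_zero.1 hf.symm

theorem spec_injective : Function.Injective spec := by
  rw [injective_iff_map_eq_zero]
  intro c h
  obtain ⟨n, f, hf⟩ := LaurentPolynomial.exists_T_pow c
  have hf0 : f = 0 := by
    ext1 i
    refine specZ_injective _ fun k => ?_
    have hx : Function.Injective fun N : ℕ => q_ k ^ (-(N + 1 : ℕ) : ℤ) := by
      intro a b hab
      have := zpow_right_injective₀ (by linarith [one_lt_q k]) (one_lt_q k).ne' hab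
      simpa using this
    exact coeff_eq_zero_of_eval₂ (specZ k) _ hx f (fun N => by
      have h1 := congrFun (congrArg spec hf) (N, k)
      rw [map_mul, h, zero_mul] at h1
      rw [spec_apply, LaurentPolynomial.eval₂_toLaurent] at h1
      simpa using h1) i
  rw [hf0, map_zero] at hf
  exact (LaurentPolynomial.isUnit_T n).mul_left_eq_zero.1 hf.symm

theorem spec_vpow (k : ℤ) (p : ℕ × ℕ) :
    spec (vpow k) p = (q_ p.2 ^ (-(p.1 + 1 : ℕ) : ℤ)) ^ k := by
  simp [spec_apply, vpow]

theorem spec_zpow_one (p : ℕ × ℕ) : spec (zpow 1) p = q_ p.2 - (q_ p.2)⁻¹ := by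
  simp [spec_apply, zpow, specZ]

/-- The specialization of the Homfly polynomial of a closed braid. -/
def specVal {m : ℕ} (β : BraidGroup (m + 1)) (p : ℕ × ℕ) : ℚ :=
  (q_ p.2 ^ (-(p.1 + 1 : ℕ) : ℤ)) ^ exponentSum β *
    qtrace (p.1 + 1) (q_ p.2) (rep (p.1 + 1) (q_ne p.2) β).val /
      ∑ k : Fin (p.1 + 1), wt (p.1 + 1) (q_ p.2) k

theorem specVal_skein {m : ℕ} (α β : BraidGroup (m + 1)) (i : Fin m) :
    spec (vpow (-1)) * specVal (α * σ i * β) - spec (vpow 1) * specVal (α * (σ i)⁻¹ * β) =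
      spec (zpow 1) * specVal (α * β) := by
  funext p
  simp only [Pi.sub_apply, Pi.mul_apply, spec_vpow, spec_zpow_one, specVal, exponentSum_mul,
    exponentSum_inv, exponentSum_σ]
  have hv : q_ p.2 ^ (-(p.1 + 1 : ℕ) : ℤ) ≠ 0 := zpow_ne_zero _ (q_ne _)
  set v := q_ p.2 ^ (-(p.1 + 1 : ℕ) : ℤ)
  have key : qtrace (p.1 + 1) (q_ p.2) (rep (p.1 + 1) (q_ne p.2) (α * σ i * β)).val -
      qtrace (p.1 + 1) (q_ p.2) (rep (p.1 + 1) (q_ne p.2) (α * (σ i)⁻¹ * β)).val =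
      (q_ p.2 - (q_ p.2)⁻¹) * qtrace (p.1 + 1) (q_ p.2) (rep (p.1 + 1) (q_ne p.2) (α * β)).val := by
    simp only [map_mul (rep _ _), Units.val_mul, rep_σ, rep_σ_inv, qtrace]
    rw [← map_sub]
    refine Eq.trans (congrArg _ ?_) (map_smul (LinearMap.trace ℚ _) (q_ p.2 - (q_ p.2)⁻¹) _)
    rw [mul_sub, sub_mul, mul_sub, mul_smul_comm, smul_mul_assoc, mul_one, sub_sub_cancel,
      mul_smul_comm]
  have e1 : v ^ (-1 : ℤ) * v ^ (exponentSum α + 1 + exponentSum β) =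
      v ^ (exponentSum α + exponentSum β) := by rw [← zpow_add₀ hv]; congr 1; ring
  have e2 : v ^ (1 : ℤ) * v ^ (exponentSum α + -1 + exponentSum β) =
      v ^ (exponentSum α + exponentSum β) := by rw [← zpow_add₀ hv]; congr 1; ring
  rw [← mul_div_assoc, ← mul_assoc, e1, ← mul_div_assoc, ← mul_assoc, e2, ← sub_div, ← mul_sub, key]
  ring

theorem specVal_stab_pos {m : ℕ} (β : BraidGroup (m + 1)) :
    specVal (addStrand β * σ (Fin.last m)) = specVal β := by
  funext p
  have hv : q_ p.2 ^ (-(p.1 + 1 : ℕ) : ℤ) ≠ 0 := zpow_ne_zero _ (q_ne _)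
  rw [specVal, specVal, qtrace_stab, exponentSum_mul, exponentSum_σ, exponentSum_addStrand,
    zpow_add_one₀ hv]
  have : q_ p.2 ^ (-(p.1 + 1 : ℕ) : ℤ) * q_ p.2 ^ ((p.1 + 1 : ℕ) : ℤ) = 1 := by
    rw [← zpow_add₀ (q_ne _)]; simp
  rw [mul_assoc, ← mul_assoc (q_ p.2 ^ (-(p.1 + 1 : ℕ) : ℤ)), this, one_mul]

theorem specVal_stab_neg {m : ℕ} (β : BraidGroup (m + 1)) :
    specVal (addStrand β * (σ (Fin.last m))⁻¹) = specVal β := by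
  have h := specVal_skein (addStrand β) 1 (Fin.last m)
  simp only [mul_one, specVal_stab_pos] at h
  funext p
  have h := congrFun h p
  have hv : q_ p.2 ^ (-(p.1 + 1 : ℕ) : ℤ) ≠ 0 := zpow_ne_zero _ (q_ne _)
  have hs := sum_wt (p.1 + 1) (q_ne p.2) (p.1 + 1)
  rw [← Finset.sum_mul, ← Fin.sum_univ_eq_sum_range] at hs
  have e3 : ((p.1 + 1 : ℕ) : ℤ) - 2 * (p.1 + 1 : ℕ) = -(p.1 + 1 : ℕ) := by ring
  rw [e3] at hs
  have ha : spec (zpow 1) p * specVal (addStrand β) p =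
      (∑ k : Fin (p.1 + 1), wt (p.1 + 1) (q_ p.2) k) * (q_ p.2 - (q_ p.2)⁻¹) * specVal β p := by
    rw [spec_zpow_one, specVal, specVal, qtrace_addStrand, exponentSum_addStrand]
    ring
  simp only [Pi.sub_apply, Pi.mul_apply, ha, hs, spec_vpow, zpow_neg_one, zpow_one] at h
  rw [← zpow_neg, neg_neg] at h
  have h' : q_ p.2 ^ (-(p.1 + 1 : ℕ) : ℤ) *
      (specVal (addStrand β * (σ (Fin.last m))⁻¹) p - specVal β p) = 0 := by
    linear_combination -h
  rcases mul_eq_zero.1 h' with h' | h'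
  · exact absurd h' hv
  · linarith

/-- The specialization of the Homfly polynomial of an oriented link. -/
def specLink : OrientedLink → ℕ × ℕ → ℚ :=
  Quot.lift (fun b => specVal b.2) (by
    rintro _ _ (⟨α, β⟩ | β | β)
    · funext p
      simp only [specVal, qtrace_comm _ _ α β, exponentSum_mul, add_comm]
    · exact (specVal_stab_pos β).symm
    · exact (specVal_stab_neg β).symm)

theorem specVal_one : specVal (1 : BraidGroup 1) = 1 := by
  funext p
  have hp : 0 < ∑ k : Fin (p.1 + 1), wt (p.1 + 1) (q_ p.2) k :=
    Finset.sum_pos (fun k _ => zpow_pos (by linarith [one_lt_q p.2]) _) Finset.univ_nonempty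
  rw [specVal, exponentSum_one, zpow_zero, one_mul, map_one, qtrace_eq]
  simp only [Units.val_one, Module.End.one_apply, Pi.single_eq_same, mul_one]
  rw [← (Equiv.funUnique (Fin 1) (Fin (p.1 + 1))).symm.sum_comp]
  simpa using div_self hp.ne'

/-- The Homfly polynomial exists. -/
theorem exists_isHomfly : ∃ P : OrientedLink → VZPoly, IsHomfly P := by
  let _ : Module VZPoly (ℕ × ℕ → ℚ) := Module.compHom _ spec
  have hsm : ∀ (r : VZPoly) (x : ℕ × ℕ → ℚ), r • x = spec r * x := fun _ _ => rfl
  have h1 : specLink (braidClosure (1 : BraidGroup 1)) = 1 := specVal_one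
  have hmem := skein_mem (Submodule.span VZPoly {(1 : ℕ × ℕ → ℚ)}) specLink
    (by rw [h1]; exact Submodule.mem_span_singleton_self _)
    (fun m α β i => by
      simp only [hsm]
      exact specVal_skein α β i)
  have hex : ∀ L, ∃ p, spec p = specLink L := fun L => by
    obtain ⟨p, hp⟩ := Submodule.mem_span_singleton.1 (hmem L)
    exact ⟨p, by rw [← hp, hsm, mul_one]⟩
  choose P hP using hex
  refine ⟨P, spec_injective (by rw [hP, h1, map_one]), fun α β i => spec_injective ?_⟩
  simp only [map_sub, map_mul, hP]
  exact specVal_skein α β i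

/-- The Homfly polynomial of an oriented link. -/
def homfly : OrientedLink → VZPoly := exists_isHomfly.choose

/-- The Homfly polynomial is the unique isotopy invariant of oriented links with the skein relation
and the normalization of `IsHomfly`. -/
theorem isHomfly_iff {P : OrientedLink → VZPoly} : IsHomfly P ↔ P = homfly :=
  ⟨fun h => h.unique exists_isHomfly.choose_spec, fun h => h ▸ exists_isHomfly.choose_spec⟩

/-! ### Columns and the Morton–Franks–Williams estimates -/

/-- The column of `P` at `v = k`: the coefficient of `v ^ k`, a Laurent polynomial in `z`. -/
def column (P : VZPoly) (k : ℤ) : ℤ[T;T⁻¹] := P.coeff k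

/-- The set of `v`-degrees of `P`: the exponents of `v` with a non-zero coefficient. -/
def vDegrees (P : VZPoly) : Set ℤ := {k | column P k ≠ 0}

/-- The left column of `P`: the coefficient of the lowest power of `v` that occurs. -/
def leftColumn (P : VZPoly) : ℤ[T;T⁻¹] := column P (sInf (vDegrees P))

/-- The right column of `P`: the coefficient of the highest power of `v` that occurs. -/
def rightColumn (P : VZPoly) : ℤ[T;T⁻¹] := column P (sSup (vDegrees P))

/-- For a braid on `n = m + 1` strands with exponent sum `w`, the lower estimate
`w - n + 1 ≤ lowest v-degree of P` is sharp, that is, an equality. -/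
def LowerMFWSharp {m : ℕ} (β : BraidGroup (m + 1)) : Prop :=
  IsLeast (vDegrees (homfly (braidClosure β))) (exponentSum β - (m + 1 : ℕ) + 1)

/-- For a braid on `n = m + 1` strands with exponent sum `w`, the upper estimate
`highest v-degree of P ≤ w + n - 1` is sharp, that is, an equality. -/
def UpperMFWSharp {m : ℕ} (β : BraidGroup (m + 1)) : Prop :=
  IsGreatest (vDegrees (homfly (braidClosure β))) (exponentSum β + (m + 1 : ℕ) - 1)

end BraidLink

end

open BraidLink

noncomputable section

open LaurentPolynomial

namespace BraidLink

/-! ### The full twist -/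

/-! Measure powers of `v` relative to the exponent sum: `braidColumn k β` is the coefficient at `v ^
(w(β) + k)`. This shift removes `v` from the skein relation, so for fixed `k` each `braidColumn k`
satisfies `f(σ) - f(σ⁻¹) = z f(1)` in context, i.e. it is a function on the Hecke algebra
(`braidColumn_heckeFun`). Such a function on `n` strands is determined by its values on `B_{n-1}`
and on `B_{n-1} σ_{n-1} B_{n-1}` (`HeckeFun.eq_zero`). Positive and negative destabilization replace
`k` by `k + 1` and `k - 1`. An induction on strands then gives the Morton–Franks–Williams bound: the
columns vanish for `|k| > n - 1` (`braidColumn_eq_zero`).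

Everything reduces to one identity between extreme columns, `braidColumn_neg_eq`: the column of `β`
at `-(n-1)` is `(-1)^(n-1)` times the column of `βΔ²` at `n-1`. Both sides are Hecke functions of
`β`, so it suffices to compare them on `B_{n-1} σ_{n-1}⁻¹ B_{n-1}` and on `B_{n-1}`.

The full twist factors as `Δ_n² = Δ_{n-1}² J`, where the Jucys–Murphy braid `J` commutes with
`B_{n-1}` and equals `σ_{n-1} J' σ_{n-1}`. Multiplication by `Δ_n²` therefore carries `B_{n-1}
σ_{n-1}⁻¹ B_{n-1}` into `B_{n-1} σ_{n-1} B_{n-1}`. On the former the lowest column vanishes and on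
the latter the highest one does, because destabilizing pushes `k` out of the permitted range. On
`B_{n-1}`, a Hecke function vanishing on `B_{n-1} σ_{n-1} B_{n-1}` is insensitive to `J`
(`HeckeFun.mul_jucysMurphy`). The split-strand formula `T_mul_braidColumn_addStrand` then reduces
the claim to `n - 1` strands and contributes one sign. -/

/-- The braid `σ₁ σ₂ ⋯ σ_m`. -/
def ascending : (m : ℕ) → BraidGroup (m + 1)
  | 0 => 1
  | m + 1 => addStrand (ascending m) * σ (Fin.last m)

/-- The braid `σ_m ⋯ σ₂ σ₁`. -/
def descending : (m : ℕ) → BraidGroup (m + 1)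
  | 0 => 1
  | m + 1 => σ (Fin.last m) * addStrand (descending m)

/-- The Jucys–Murphy braid `σ_m ⋯ σ₂ σ₁ σ₁ σ₂ ⋯ σ_m`: the last strand goes once around all the
others. -/
def jucysMurphy : (m : ℕ) → BraidGroup (m + 1)
  | 0 => 1
  | m + 1 => σ (Fin.last m) * addStrand (jucysMurphy m) * σ (Fin.last m)

/-- Trades the list product in the definition of `garside` for a recursion that peels off the last
generator, as induction on the number of strands needs. -/
theorem ofFn_σ_prod (m : ℕ) : (List.ofFn fun i : Fin m => σ i).prod = ascending m := by
  induction m with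
  | zero => simp [ascending]
  | succ m ih =>
    rw [List.ofFn_succ', List.concat_eq_append, List.prod_append, ascending, ← ih, map_list_prod,
      List.map_ofFn]
    simp [Function.comp_def, addStrand_σ]

theorem descending_mul_ascending (m : ℕ) : descending m * ascending m = jucysMurphy m := by
  induction m with
  | zero => simp [descending, ascending, jucysMurphy]
  | succ m ih => rw [descending, ascending, jucysMurphy, ← ih, map_mul]; group

theorem garside_succ (m : ℕ) :
    garside (m + 1) = ascending (m + 1) * addStrand (garside m) := by
  rw [garside, ofFn_σ_prod]

/-- The mirror form of the recursion for `Δ`. It follows by moving the last generator past `Δ` on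
two fewer strands, with which it commutes. -/
theorem garside_succ' (m : ℕ) :
    garside (m + 1) = addStrand (garside m) * descending (m + 1) := by
  induction m with
  | zero => simp [garside, descending]
  | succ m ih =>
    calc garside (m + 2)
        = addStrand (ascending (m + 1)) *
            (σ (Fin.last (m + 1)) * addStrand (addStrand (garside m))) *
              addStrand (descending (m + 1)) := by
          rw [garside_succ, ascending, ih, map_mul]; group
      _ = addStrand (ascending (m + 1) * addStrand (garside m)) * descending (m + 2) := by
          rw [← addStrand_addStrand_comm, map_mul, show descending (m + 2) =
            σ (Fin.last (m + 1)) * addStrand (descending (m + 1)) from rfl]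
          group
      _ = _ := by rw [← garside_succ]

/-- Geometrically, the last strand encircles all the others, so any braiding of those slides through
the loop. Algebraically, only the generator adjacent to the last one needs the braid relation; the
earlier ones follow by induction. -/
theorem jucysMurphy_commute (m : ℕ) (a : BraidGroup (m + 1)) :
    Commute (addStrand a) (jucysMurphy (m + 1)) := by
  have gen : ∀ i : Fin m, Commute (addStrand (σ i)) (jucysMurphy (m + 1)) := by
    induction m with
    | zero => exact fun i => i.elim0
    | succ m ih =>
      intro i
      rw [jucysMurphy, addStrand_σ]
      induction i using Fin.lastCases with
      | cast i =>
        have h : Commute (σ i.castSucc.castSucc) (σ (Fin.last (m + 1))) := σ_comm _ _ (by simp)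
        refine (h.mul_right ?_).mul_right h
        have := (ih (σ i) i).map (addStrand (m := m + 1))
        rwa [addStrand_σ, addStrand_σ] at this
      | last =>
        have hb : σ (Fin.last m).castSucc * σ (Fin.last (m + 1)) * σ (Fin.last m).castSucc =
          σ (Fin.last (m + 1)) * σ (Fin.last m).castSucc * σ (Fin.last (m + 1)) :=
          σ_braid _ _ (by simp)
        have hc := addStrand_addStrand_comm (jucysMurphy m)
        simp only [jucysMurphy, map_mul, addStrand_σ]
        generalize σ (Fin.last m).castSucc = u at *
        generalize σ (Fin.last (m + 1)) = s at *
        generalize addStrand (addStrand (jucysMurphy m)) = x at *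
        calc u * (s * (u * x * u) * s) = (u * s * u) * x * (u * s) := by group
          _ = s * u * (s * x) * (u * s) := by rw [hb]; group
          _ = s * u * x * (s * u * s) := by rw [← hc]; group
          _ = s * (u * x * u) * s * u := by rw [← hb]; group
  induction a using braid_induction with
  | one => simp
  | mul a b ha hb => rw [map_mul]; exact ha.mul_left hb
  | gen i => exact gen i
  | inv i => rw [map_inv]; exact (gen i).inv_left

/-- Writing one factor `Δ` in each of its two recursive forms brings `descending` next to
`ascending`. Their product is the Jucys–Murphy braid, which then commutes to the right end. -/
theorem garside_succ_sq (m : ℕ) :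
    garside (m + 1) ^ 2 = addStrand (garside m ^ 2) * jucysMurphy (m + 1) := by
  rw [sq, sq]
  nth_rw 1 [garside_succ']
  rw [garside_succ, mul_assoc, ← mul_assoc (descending _), descending_mul_ascending,
    ← (jucysMurphy_commute m _).eq, map_mul, mul_assoc]

/-! ### Functions on the Hecke algebra -/

/-- Functions on a braid group that descend to the Hecke algebra with the quadratic relation
`σ - σ⁻¹ = z`. -/
def HeckeFun {m : ℕ} (f : BraidGroup (m + 1) → ℤ[T;T⁻¹]) : Prop :=
  ∀ (α β : BraidGroup (m + 1)) (i : Fin m),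
    f (α * σ i * β) - f (α * (σ i)⁻¹ * β) = T 1 * f (α * β)

/-- The factor `v ^ w(β)` restores the powers of `v` in the skein relation, so that the reduction
`SkeinFun.mem` becomes available for Hecke functions. -/
theorem HeckeFun.skeinFun {m : ℕ} {f : BraidGroup (m + 1) → ℤ[T;T⁻¹]} (hf : HeckeFun f) :
    SkeinFun fun β => vpow (exponentSum β) * C (f β) := fun α β i => by
  have e : ∀ k l : ℤ, ∀ c : VZPoly, vpow k * (vpow l * c) = vpow (k + l) * c := fun k l c => by
    rw [← mul_assoc, ← T_add]
  have e₁ : -1 + (exponentSum α + 1 + exponentSum β) = exponentSum α + exponentSum β := by ring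
  have e₂ : 1 + (exponentSum α + -1 + exponentSum β) = exponentSum α + exponentSum β := by ring
  simp only [smul_eq_mul, exponentSum_mul, exponentSum_inv, exponentSum_σ, e, e₁, e₂]
  rw [← mul_sub, ← map_sub, hf, map_mul]
  ring

/-- A function on the Hecke algebra vanishes if it does so on `B_{n-1}` and
`B_{n-1} σ_{n-1} B_{n-1}`. -/
theorem HeckeFun.eq_zero {m : ℕ} {f : BraidGroup (m + 2) → ℤ[T;T⁻¹]} (hf : HeckeFun f)
    (h₀ : ∀ a, f (addStrand a) = 0)
    (h₁ : ∀ a b, f (addStrand a * σ (Fin.last m) * addStrand b) = 0) (β : BraidGroup (m + 2)) :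
    f β = 0 := by
  -- Membership in the zero submodule is vanishing; afterwards the unit `v ^ w(β)` is cancelled and
  -- the coefficient of `v ^ 0` is read off.
  have h := hf.skeinFun.mem ⊥ (by simp [h₀]) (by simp [h₁]) β
  rw [Submodule.mem_bot] at h
  have h' := congrArg (fun x => vpow (-exponentSum β) * x) h
  simp only [← mul_assoc, ← T_add, neg_add_cancel, T_zero, one_mul, mul_zero] at h'
  simpa [C_apply] using congrArg (fun x : VZPoly => x.coeff 0) h'

theorem HeckeFun.translate {m : ℕ} {f : BraidGroup (m + 1) → ℤ[T;T⁻¹]} (hf : HeckeFun f)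
    (γ : BraidGroup (m + 1)) : HeckeFun fun x => f (x * γ) := fun α β i => by
  simpa only [mul_assoc] using hf α (β * γ) i

/-- A function on the Hecke algebra that vanishes on `B_{n-1} σ_{n-1} B_{n-1}` does not see the
Jucys–Murphy braid. -/
theorem HeckeFun.mul_jucysMurphy {m : ℕ} {f : BraidGroup (m + 2) → ℤ[T;T⁻¹]} (hf : HeckeFun f)
    (h₁ : ∀ a b, f (addStrand a * σ (Fin.last m) * addStrand b) = 0) (c : BraidGroup (m + 1)) :
    f (addStrand c * jucysMurphy (m + 1)) = f (addStrand c) := by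
  induction m with
  | zero =>
    have h := hf (addStrand c * σ (Fin.last 0)) 1 (Fin.last 0)
    have h' := h₁ c 1
    simp only [map_one, mul_one] at h'
    simp only [mul_one, mul_inv_cancel_right, h', mul_zero, sub_eq_zero] at h
    simpa [jucysMurphy, mul_assoc] using h
  | succ m ih =>
    set s : BraidGroup (m + 3) := σ (Fin.last (m + 1)) with hs
    have hc : ∀ d : BraidGroup (m + 1), _ := addStrand_addStrand_comm
    rw [← hs] at hc
    -- With `J = s J' s`, the quadratic relation turns the final `s` into `s⁻¹` at the cost of `z
    -- f(c s J')`, which is zero by `h₁`. What remains is conjugation by `s`. As a function of the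
    -- inner braid it again satisfies the hypotheses, so induction removes `J'` and `s s⁻¹` cancels.
    have step := ih (f := fun x => f (addStrand c * s * addStrand x * s⁻¹)) ?_ ?_ 1
    · have h := hf (addStrand c * s * addStrand (jucysMurphy (m + 1))) 1 (Fin.last (m + 1))
      simp only [mul_one, h₁, mul_zero, sub_eq_zero, ← hs] at h
      simp only [map_one, mul_one, one_mul, mul_inv_cancel_right] at step
      rw [jucysMurphy, ← hs, ← step, ← h]
      simp only [mul_assoc]
    · intro α β i
      have := hf (addStrand c * s * addStrand α) (addStrand β * s⁻¹) i.castSucc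
      simpa only [mul_assoc, map_mul, map_inv, addStrand_σ] using this
    · intro a b
      have e : addStrand c * s * addStrand (addStrand a * σ (Fin.last m) * addStrand b) * s⁻¹ =
          addStrand (c * addStrand a * (σ (Fin.last m))⁻¹) * s *
            addStrand (σ (Fin.last m) * addStrand b) := by
        simp only [map_mul, map_inv, addStrand_σ]
        have hb : σ (Fin.last m).castSucc * s * σ (Fin.last m).castSucc =
          s * σ (Fin.last m).castSucc * s := σ_braid _ _ (by simp)
        generalize σ (Fin.last m).castSucc = u at *
        -- This form of the braid relation turns the inner crossing `u`, conjugated by `s`, into a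
        -- single `s` between braids on fewer strands, where `f` vanishes.
        have hb' : s * u * s⁻¹ = u⁻¹ * s * u := by
          rw [mul_inv_eq_iff_eq_mul, mul_assoc, mul_assoc, eq_inv_mul_iff_mul_eq]
          simpa only [mul_assoc] using hb
        have hd : addStrand (addStrand b) * s⁻¹ = s⁻¹ * addStrand (addStrand b) :=
          (Commute.inv_right (hc b : Commute _ _)).eq
        calc _ = addStrand c * (s * addStrand (addStrand a)) * u *
              (addStrand (addStrand b) * s⁻¹) := by group
          _ = addStrand c * addStrand (addStrand a) * (s * u * s⁻¹) *
              addStrand (addStrand b) := by rw [hd, ← hc a]; group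
          _ = _ := by rw [hb']; group
      show f _ = 0
      rw [e]
      exact h₁ _ _

/-! ### Columns of the Homfly polynomial of a closed braid -/

theorem column_vpow_mul (k j : ℤ) (P : VZPoly) : column (vpow k * P) j = column P (j - k) := by
  rw [column, column, vpow, T, AddMonoidAlgebra.coeff_single_mul_apply, one_mul]
  congr 1; ring

theorem column_zpow_mul (k j : ℤ) (P : VZPoly) : column (zpow k * P) j = T k * column P j := by
  rw [column, column, zpow, ← LaurentPolynomial.smul_eq_C_mul]; rfl

theorem column_sub (P Q : VZPoly) (j : ℤ) : column (P - Q) j = column P j - column Q j := rfl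

theorem homfly_spec : IsHomfly homfly := isHomfly_iff.2 rfl

/-- The column of the Homfly polynomial of the closure of `β` at the power `w(β) + k` of `v`. -/
def braidColumn (k : ℤ) {m : ℕ} (β : BraidGroup (m + 1)) : ℤ[T;T⁻¹] :=
  column (homfly (braidClosure β)) (exponentSum β + k)

/-- The three exponent sums in the skein relation differ by exactly the powers of `v` in its
coefficients, so a single coefficient comparison involves the same offset `k` throughout. -/
theorem braidColumn_heckeFun (k : ℤ) (m : ℕ) :
    HeckeFun (braidColumn k : BraidGroup (m + 1) → ℤ[T;T⁻¹]) := fun α β i => by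
  have h := congrArg (fun P => column P (exponentSum α + exponentSum β + k))
    (homfly_spec.skein α β i)
  simp only [column_sub, column_vpow_mul, column_zpow_mul] at h
  simp only [braidColumn, exponentSum_mul, exponentSum_inv, exponentSum_σ]
  rw [← h]
  congr 2 <;> ring

theorem braidColumn_mul_comm (k : ℤ) {m : ℕ} (α β : BraidGroup (m + 1)) :
    braidColumn k (α * β) = braidColumn k (β * α) := by
  have : braidClosure (α * β) = braidClosure (β * α) := Quot.sound (MarkovMove.conj α β)
  rw [braidColumn, braidColumn, this, exponentSum_mul, exponentSum_mul, add_comm (exponentSum α)]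

/-- The closure is unchanged while the exponent sum grows by one, so the same column sits at a
shifted offset. -/
theorem braidColumn_stab_pos (k : ℤ) {m : ℕ} (β : BraidGroup (m + 1)) :
    braidColumn k (addStrand β * σ (Fin.last m)) = braidColumn (k + 1) β := by
  have : braidClosure (addStrand β * σ (Fin.last m)) = braidClosure β :=
    (Quot.sound (MarkovMove.stab_pos β)).symm
  rw [braidColumn, braidColumn, this, exponentSum_mul, exponentSum_addStrand, exponentSum_σ]
  congr 1; ring

theorem braidColumn_stab_neg (k : ℤ) {m : ℕ} (β : BraidGroup (m + 1)) :
    braidColumn k (addStrand β * (σ (Fin.last m))⁻¹) = braidColumn (k - 1) β := by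
  have : braidClosure (addStrand β * (σ (Fin.last m))⁻¹) = braidClosure β :=
    (Quot.sound (MarkovMove.stab_neg β)).symm
  rw [braidColumn, braidColumn, this, exponentSum_mul, exponentSum_addStrand, exponentSum_inv,
    exponentSum_σ]
  congr 1; ring

theorem braidColumn_pos (k : ℤ) {m : ℕ} (a b : BraidGroup (m + 1)) :
    braidColumn k (addStrand a * σ (Fin.last m) * addStrand b) = braidColumn (k + 1) (b * a) := by
  rw [braidColumn_mul_comm, ← mul_assoc, ← map_mul, braidColumn_stab_pos]

theorem braidColumn_neg (k : ℤ) {m : ℕ} (a b : BraidGroup (m + 1)) :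
    braidColumn k (addStrand a * (σ (Fin.last m))⁻¹ * addStrand b) =
      braidColumn (k - 1) (b * a) := by
  rw [braidColumn_mul_comm, ← mul_assoc, ← map_mul, braidColumn_stab_neg]

/-- The Hecke relation at a crossing with the added strand: both crossed versions destabilize to
`a`, and the smoothed one is `a` with a split unknot. -/
theorem T_mul_braidColumn_addStrand (k : ℤ) {m : ℕ} (a : BraidGroup (m + 1)) :
    T 1 * braidColumn k (addStrand a) = braidColumn (k + 1) a - braidColumn (k - 1) a := by
  have := braidColumn_heckeFun k (m + 1) (addStrand a) 1 (Fin.last m)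
  simpa only [mul_one, braidColumn_stab_pos, braidColumn_stab_neg] using this.symm

/-- The Morton–Franks–Williams estimates. -/
theorem braidColumn_eq_zero {m : ℕ} (β : BraidGroup (m + 1)) (k : ℤ) (hk : (m : ℤ) < |k|) :
    braidColumn k β = 0 := by
  induction m generalizing k with
  | zero =>
    have hβ : β = 1 := by
      induction β using braid_induction with
      | one => rfl
      | mul a b ha hb => rw [ha, hb, mul_one]
      | gen i => exact i.elim0
      | inv i => exact i.elim0
    have hk0 : k ≠ 0 := by rintro rfl; simp at hk
    rw [braidColumn, hβ, homfly_spec.unknot, exponentSum_one, zero_add, column, ← T_zero, T_apply,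
      if_neg hk0.symm]
  | succ m ih =>
    -- Removing a strand lowers the bound by one and moves `k` by one, so `k` stays out of range.
    -- Bounding `|k|` treats both estimates in one induction, which is needed because the
    -- split-strand formula involves both `k + 1` and `k - 1`.
    have h₁ : (m : ℤ) < |k + 1| := by push_cast at hk; grind
    have h₂ : (m : ℤ) < |k - 1| := by push_cast at hk; grind
    refine (braidColumn_heckeFun k (m + 1)).eq_zero (fun a => ?_) (fun a b => ?_) β
    · refine (isUnit_T 1).mul_right_eq_zero.1 ?_
      rw [T_mul_braidColumn_addStrand, ih a _ h₁, ih a _ h₂, sub_zero]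
    · rw [braidColumn_pos, ih _ _ h₁]

/-- The extreme columns of the Homfly polynomials of `β` and of `β Δ²`. -/
theorem braidColumn_neg_eq {m : ℕ} (β : BraidGroup (m + 1)) :
    braidColumn (-m) β = (-1) ^ m * braidColumn m (β * garside m ^ 2) := by
  induction m with
  | zero => simp [garside]
  | succ m ih =>
    have hz : ∀ a b : BraidGroup (m + 1), braidColumn ((m + 1 : ℕ) : ℤ)
        (addStrand a * σ (Fin.last m) * addStrand b) = 0 := fun a b => by
      rw [braidColumn_pos]
      exact braidColumn_eq_zero _ _ (by push_cast; grind)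
    set D : BraidGroup (m + 2) → ℤ[T;T⁻¹] := fun x => braidColumn (-(m + 1 : ℕ)) x -
      (-1) ^ (m + 1) * braidColumn (m + 1 : ℕ) (x * garside (m + 1) ^ 2) with hD
    have hDf : HeckeFun D := fun α β i => by
      have h₁ := braidColumn_heckeFun (-(m + 1 : ℕ)) (m + 1) α β i
      have h₂ := (braidColumn_heckeFun (m + 1 : ℕ) (m + 1)).translate (garside (m + 1) ^ 2) α β i
      simp only [hD]
      linear_combination h₁ - (-1) ^ (m + 1) * h₂
    have h₀ : ∀ a, D (addStrand a) = 0 := fun a => by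
      refine (isUnit_T 1).mul_right_eq_zero.1 ?_
      have h₁ := T_mul_braidColumn_addStrand (-(m + 1 : ℕ)) a
      have h₂ := T_mul_braidColumn_addStrand (m + 1 : ℕ) (a * garside m ^ 2)
      -- At the lowest offset only the `k + 1` term of the split-strand formula survives, at the
      -- highest only the `k - 1` term. These enter with opposite signs, which is the source of the
      -- extra factor `-1` per strand.
      rw [braidColumn_eq_zero _ (_ - 1) (by push_cast; grind)] at h₁
      rw [braidColumn_eq_zero _ (_ + 1) (by push_cast; grind)] at h₂
      have e₁ : -((m + 1 : ℕ) : ℤ) + 1 = -m := by push_cast; ring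
      have e₂ : ((m + 1 : ℕ) : ℤ) - 1 = m := by push_cast; ring
      rw [e₁, ih] at h₁
      rw [e₂] at h₂
      simp only [hD]
      rw [garside_succ_sq, ← mul_assoc, ← map_mul,
        (braidColumn_heckeFun (m + 1 : ℕ) (m + 1)).mul_jucysMurphy hz]
      linear_combination h₁ - (-1) ^ (m + 1) * h₂
    -- The negative crossing is the one for which both terms of `D` vanish separately: it kills the
    -- lowest column directly, and `J = σ J' σ` absorbs `σ⁻¹` to leave one positive crossing, which
    -- kills the highest column.
    have hneg : ∀ a b, D (addStrand a * (σ (Fin.last m))⁻¹ * addStrand b) = 0 := fun a b => by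
      have e : addStrand a * (σ (Fin.last m))⁻¹ * addStrand b * garside (m + 1) ^ 2 =
          addStrand (a * jucysMurphy m) * σ (Fin.last m) * addStrand (b * garside m ^ 2) := by
        rw [garside_succ_sq, mul_assoc _ (addStrand b), ← mul_assoc (addStrand b), ← map_mul,
          (jucysMurphy_commute m _).eq, jucysMurphy, map_mul, map_mul]
        group
      simp only [hD]
      rw [e, hz, braidColumn_neg, braidColumn_eq_zero _ _ (by push_cast; grind)]
      simp
    refine sub_eq_zero.1 (hDf.eq_zero h₀ (fun a b => ?_) β)
    -- The Hecke relation passes from `σ⁻¹` to the `σ` required by `HeckeFun.eq_zero`; the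
    -- correction is a multiple of `D` on `B_{n-1}`, already known to vanish.
    have h := hDf (addStrand a) (addStrand b) (Fin.last m)
    rwa [hneg, ← map_mul, h₀, mul_zero, sub_zero] at h

/-! ### Sharpness as non-vanishing of the extreme columns -/

theorem vDegrees_subset {m : ℕ} (β : BraidGroup (m + 1)) :
    vDegrees (homfly (braidClosure β)) ⊆ Set.Icc (exponentSum β - m) (exponentSum β + m) := by
  intro j hj
  by_contra h
  refine hj ?_
  have := braidColumn_eq_zero β (j - exponentSum β) (by rw [Set.mem_Icc] at h; grind)
  rwa [braidColumn, add_sub_cancel] at this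

/-- The bound itself always holds by `vDegrees_subset`, so being least amounts to the extreme degree
occurring at all. -/
theorem lowerMFWSharp_iff {m : ℕ} (β : BraidGroup (m + 1)) :
    LowerMFWSharp β ↔ braidColumn (-m) β ≠ 0 := by
  have e : exponentSum β - (m + 1 : ℕ) + 1 = exponentSum β + -m := by push_cast; ring
  rw [LowerMFWSharp, e]
  exact ⟨fun h => h.1, fun h => ⟨h, fun j hj => (vDegrees_subset β hj).1⟩⟩

theorem upperMFWSharp_iff {m : ℕ} (β : BraidGroup (m + 1)) :
    UpperMFWSharp β ↔ braidColumn m β ≠ 0 := by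
  have e : exponentSum β + (m + 1 : ℕ) - 1 = exponentSum β + m := by push_cast; ring
  rw [UpperMFWSharp, e]
  exact ⟨fun h => h.1, fun h => ⟨h, fun j hj => (vDegrees_subset β hj).2⟩⟩

theorem LowerMFWSharp.leftColumn_eq {m : ℕ} {β : BraidGroup (m + 1)} (h : LowerMFWSharp β) :
    leftColumn (homfly (braidClosure β)) = braidColumn (-m) β := by
  rw [leftColumn, IsLeast.csInf_eq h, braidColumn]
  congr 1; push_cast; ring

theorem UpperMFWSharp.rightColumn_eq {m : ℕ} {β : BraidGroup (m + 1)} (h : UpperMFWSharp β) :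
    rightColumn (homfly (braidClosure β)) = braidColumn m β := by
  rw [rightColumn, IsGreatest.csSup_eq h, braidColumn]
  congr 1; push_cast; ring

end BraidLink

end

open BraidLink
theorem mainTheorem2 (m : ℕ) (β : BraidGroup (m + 1)) :
    (LowerMFWSharp β ↔ UpperMFWSharp (β * garside m ^ 2)) ∧
    (LowerMFWSharp β →
      leftColumn (homfly (braidClosure β)) =
        (-1) ^ m * rightColumn (homfly (braidClosure (β * garside m ^ 2)))) := by
  have hiff : LowerMFWSharp β ↔ UpperMFWSharp (β * garside m ^ 2) := by
    -- The sign `(-1) ^ m` is a unit, so the two extreme columns vanish together.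
    have hu := (isUnit_one (M := LaurentPolynomial ℤ)).neg.pow m
    rw [lowerMFWSharp_iff, upperMFWSharp_iff, braidColumn_neg_eq, Ne, hu.mul_right_eq_zero]
  refine ⟨hiff, fun h => ?_⟩
  rw [h.leftColumn_eq, (hiff.1 h).rightColumn_eq, braidColumn_neg_eq]
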